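/- Let $\mathrm{ZFC}^-$ denote $\mathrm{ZFC}$ without the power set axiom, with replacement strengthened to collection and with choice strengthened to the principle that every set can be well-ordered. Let $\hat V=(V,\hat\in)$ be a model of $\mathrm{ZFC}^-$ that is $\omega$-nonstandard, i.e. some natural number of $\hat V$ (element of $\hat\omega=\omega^{\hat V}$) has infinitely many predecessors; order $\hat\omega$ by $\hat\in$. For infinite regular cardinals $\kappa,\theta$, a $(\kappa,\theta)$-cut in a linear order $(L,<)$ is a pair of sequences $(a_\alpha)_{\alpha<\kappa}$, $(b_\beta)_{\beta<\theta}$ from $L$, the first strictly increasing, the second strictly decreasing, with $a_\alpha<b_\beta$ for all $\alpha,\beta$, such that no $c\in L$ satisfies $a_\alpha<c<b_\beta$ for all $\alpha,\beta$. Let $\mathcal C_{\hat V}$ be the set of all $(\kappa,\theta)$ such that $(\hat\omega,\hat<)$ admits a $(\kappa,\theta)$-cut, and let $\mathfrak p_{\hat V}=\min\{\kappa+\theta:(\kappa,\theta)\in\mathcal C_{\hat V}\}$. Let $\mathfrak t_{\hat V}$ be the least cardinal $\kappa$ such that for some $\hat n\in\hat\omega$ with $\hat n\ne 0$ there is a strictly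 increasing sequence $(s_\alpha)_{\alpha<\kappa}$ without upper bound in the tree $\hat n^{<\hat n}$, computed in $\hat V$, of all functions from some $\hat m<\hat n$ to $\hat n$, ordered by inclusion. (A minimum over the empty set is read as $\infty$.) If $\mathfrak p_{\hat V}<\mathfrak t_{\hat V}$ and $\kappa=\mathfrak p_{\hat V}$, then $(\kappa,\kappa)\notin\mathcal C_{\hat V}$, i.e. $(\hat\omega,\hat<)$ admits no $(\kappa,\kappa)$-cut. -/

import Mathlib

universe u

open FirstOrder Cardinal

noncomputable section

/-! ### Cut spectrum of a linear order, and tree-tops of a tree -/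

/-- A `(κ, θ)`-pre-cut in `(L, <)`: a strictly increasing sequence `(a_α : α < κ)` lying below a
strictly decreasing sequence `(b_β : β < θ)`, where `κ`, `θ` are infinite regular cardinals. -/
structure IsPreCut {L : Type u} [LT L] (κ θ : Cardinal.{u})
    (a : Set.Iio κ.ord → L) (b : Set.Iio θ.ord → L) : Prop where
  regular_left : κ.IsRegular
  regular_right : θ.IsRegular
  left_increasing : ∀ α α', α < α' → a α < a α'
  right_decreasing : ∀ β β', β < β' → b β' < b β
  left_lt_right : ∀ α β, a α < b β

/-- A `(κ, θ)`-cut: a pre-cut such that no `c` lies strictly between the two sequences. -/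
def IsCut {L : Type u} [LT L] (κ θ : Cardinal.{u})
    (a : Set.Iio κ.ord → L) (b : Set.Iio θ.ord → L) : Prop :=
  IsPreCut κ θ a b ∧ ¬ ∃ c : L, (∀ α, a α < c) ∧ (∀ β, c < b β)

/-- The cut spectrum `C(L, <)`: all `(κ, θ)` such that `L` admits a `(κ, θ)`-cut. -/
def cutSpectrum (L : Type u) [LT L] : Set (Cardinal.{u} × Cardinal.{u}) :=
  {c | ∃ a b, IsCut (L := L) c.1 c.2 a b}

/-- `cut(L, <) = min {κ + θ : (κ, θ) ∈ C(L, <)}`; its value is `⊤` if there is no cut at all. -/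
def cutCard (L : Type u) [LT L] : WithTop Cardinal.{u} :=
  ⨅ c ∈ cutSpectrum L, ((c.1 + c.2 : Cardinal.{u}) : WithTop Cardinal.{u})

/-- `T` has a (strictly) increasing sequence of length `κ` with no upper bound in `T`. -/
def HasUnboundedChain (T : Type u) [Preorder T] (κ : Cardinal.{u}) : Prop :=
  ∃ s : Set.Iio κ.ord → T, StrictMono s ∧ ¬ ∃ t : T, ∀ α, s α ≤ t

/-- `tree-tops(T)`: the least `κ` such that some increasing sequence of length `κ` in `T` has no
upper bound in `T`; its value is `⊤` if there is no such `κ` (as happens for finite trees). -/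
def treeTops (T : Type u) [Preorder T] : WithTop Cardinal.{u} :=
  ⨅ κ ∈ {κ : Cardinal.{u} | HasUnboundedChain T κ}, (κ : WithTop Cardinal.{u})

/-! ### The language of set theory and its structures -/

/-- The relation symbols of the language of set theory: one binary symbol. -/
inductive SetLangRel : ℕ → Type
  | mem : SetLangRel 2

/-- The first-order language of set theory. -/
def setLanguage : Language := ⟨fun _ => Empty, SetLangRel⟩

namespace SetModel

variable {V : Type u} [setLanguage.Structure V]

/-- The membership relation of the structure `V`. -/
def VMem (x y : V) : Prop := Language.Structure.RelMap (L := setLanguage) SetLangRel.mem ![x, y]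

infix:50 " ∈ᵥ " => VMem

/-- In `V`: `x` is the empty set. -/
def IsEmptySet (x : V) : Prop := ∀ z, ¬ z ∈ᵥ x

/-- In `V`: `y = x ∪ {x}`. -/
def IsSuccessor (y x : V) : Prop := ∀ z, z ∈ᵥ y ↔ z ∈ᵥ x ∨ z = x

/-- In `V`: `x` contains the empty set and is closed under `y ↦ y ∪ {y}`. -/
def IsInductive (x : V) : Prop :=
  (∃ e, IsEmptySet e ∧ e ∈ᵥ x) ∧ ∀ y, y ∈ᵥ x → ∃ y', IsSuccessor y' y ∧ y' ∈ᵥ x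

/-- In `V`: `w = {a, b}`. -/
def IsUnorderedPair (w a b : V) : Prop := ∀ z, z ∈ᵥ w ↔ z = a ∨ z = b

/-- In `V`: `p` is the (Kuratowski) ordered pair `(a, b) = {{a}, {a, b}}`. -/
def IsOrderedPair (p a b : V) : Prop :=
  ∀ w, w ∈ᵥ p ↔ IsUnorderedPair w a a ∨ IsUnorderedPair w a b

/-- In `V`: `(a, b) ∈ r`. -/
def PairMem (r a b : V) : Prop := ∃ p, IsOrderedPair p a b ∧ p ∈ᵥ r

/-- In `V`: the relation `{(a, b) : (a, b) ∈ r}` is a strict well-ordering of the set `x`. -/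
structure IsWellOrderOf (r x : V) : Prop where
  irrefl : ∀ a, a ∈ᵥ x → ¬ PairMem r a a
  trans : ∀ a b c, a ∈ᵥ x → b ∈ᵥ x → c ∈ᵥ x → PairMem r a b → PairMem r b c → PairMem r a c
  total : ∀ a b, a ∈ᵥ x → b ∈ᵥ x → PairMem r a b ∨ a = b ∨ PairMem r b a
  least : ∀ y, (∀ a, a ∈ᵥ y → a ∈ᵥ x) → (∃ a, a ∈ᵥ y) →
    ∃ m, m ∈ᵥ y ∧ ∀ a, a ∈ᵥ y → a = m ∨ PairMem r m a

end SetModel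

open SetModel

/-- `V ⊨ ZFC⁻`: the structure `V` satisfies extensionality, foundation, pairing, union, infinity,
the separation scheme, the collection scheme and the well-ordering principle (there is no power set
axiom). The two schemes range over all first-order formulas with arbitrary parameters from `V`,
that is, over the classes and binary class relations definable in `V` with parameters. -/
class ModelsZFCMinus (V : Type u) [setLanguage.Structure V] : Prop where
  extensionality : ∀ x y : V, (∀ z, z ∈ᵥ x ↔ z ∈ᵥ y) → x = y
  foundation : ∀ x : V, (∃ y, y ∈ᵥ x) → ∃ y, y ∈ᵥ x ∧ ∀ z, z ∈ᵥ y → ¬ z ∈ᵥ x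
  pairing : ∀ a b : V, ∃ w, IsUnorderedPair w a b
  union : ∀ x : V, ∃ y, ∀ z, z ∈ᵥ y ↔ ∃ w, w ∈ᵥ x ∧ z ∈ᵥ w
  infinity : ∃ x : V, IsInductive x
  separation : ∀ D : Set V, (Set.univ : Set V).Definable₁ setLanguage D →
    ∀ x : V, ∃ y, ∀ z, z ∈ᵥ y ↔ z ∈ᵥ x ∧ z ∈ D
  collection : ∀ R : Set (V × V), (Set.univ : Set V).Definable₂ setLanguage R →
    ∀ x : V, (∀ a, a ∈ᵥ x → ∃ b, (a, b) ∈ R) → ∃ y, ∀ a, a ∈ᵥ x → ∃ b, b ∈ᵥ y ∧ (a, b) ∈ R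
  wellOrdering : ∀ x : V, ∃ r, IsWellOrderOf r x

/-! ### The natural numbers of `V` and the cardinals attached to `V` -/

section

variable (V : Type u) [setLanguage.Structure V]

/-- The set of natural numbers of `V` (the elements of `ω` as computed in `V`): those elements
of `V` which belong to every inductive set of `V`. -/
def OmegaHat : Type u := {n : V // ∀ x : V, IsInductive x → n ∈ᵥ x}

/-- The natural numbers of `V` are ordered by the membership relation of `V`. -/
instance : LT (OmegaHat V) := ⟨fun m n => m.1 ∈ᵥ n.1⟩

/-- `V` is `ω`-nonstandard: some natural number of `V` has infinitely many predecessors. -/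
def OmegaNonstandard : Prop := ∃ n : OmegaHat V, {m : OmegaHat V | m < n}.Infinite

variable {V}

/-- In `V`: `s` is a function with domain `m` and with values in `n`. -/
def IsFunctionFromTo (s m n : V) : Prop :=
  (∀ p, p ∈ᵥ s → ∃ i a, i ∈ᵥ m ∧ a ∈ᵥ n ∧ IsOrderedPair p i a) ∧
    ∀ i, i ∈ᵥ m → ∃! a, PairMem s i a

/-- The tree `n^{<n}` as computed in `V`: all `s` in `V` which, in the sense of `V`, are functions
from some `m < n` to `n`. -/
def SeqTree (n : OmegaHat V) : Type u :=
  {s : V // ∃ m : OmegaHat V, m < n ∧ IsFunctionFromTo s m.1 n.1}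

/-- The tree `n^{<n}` is ordered by inclusion in the sense of `V`. -/
instance (n : OmegaHat V) [ModelsZFCMinus V] : PartialOrder (SeqTree n) where
  le s t := ∀ z, z ∈ᵥ s.1 → z ∈ᵥ t.1
  le_refl _ _ h := h
  le_trans _ _ _ h h' z hz := h' z (h z hz)
  le_antisymm s t h h' :=
    Subtype.ext (ModelsZFCMinus.extensionality s.1 t.1 fun z => ⟨h z, h' z⟩)

variable (V)

/-- The cardinal `𝔭_V`, the least `κ + θ` such that `V`'s natural numbers admit a
`(κ, θ)`-cut. -/
def pCard : WithTop Cardinal.{u} := cutCard (OmegaHat V)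

/-- The cardinal `𝔱_V`, the minimum of `tree-tops(n^{<n})` over the natural numbers `n ≠ 0`
of `V` (the set `0^{<0}` is empty, hence not a tree). -/
def tCard [ModelsZFCMinus V] : WithTop Cardinal.{u} :=
  ⨅ n ∈ {n : OmegaHat V | ∃ m, m < n}, treeTops (SeqTree n)

end

end

/-!
Suppose `(a α)`, `(b α)`, for `α < κ`, is a symmetric cut in the natural numbers of `V`, where
`κ < 𝔱`. A pair `(a α, b α)` is encoded by an element of the tree `n^{<n}`, where `n` is the
successor of `b 0`: a weakly decreasing function with domain `{0, …, a α}` whose last value is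
`b α` (`SetModel.Encodes`). Since its domain is determined by `a α`, such a function always has length
less than `n`, and since its values are at least `b α > a α`, it lies above the identity.

Such functions can be chosen to form a chain, by transfinite recursion
(`IsPreCut.exists_chain_encodes`). As `κ < 𝔱`, the functions chosen before stage `α` have an upper
bound `t` in the tree (`exists_upperBound_of_strictMono`). Nothing is known about `t` beyond those
functions, but `V` can cut it down to the largest initial segment below `a α` on which it is decreasing
with values greater than `b α`, and continue it with the constant value `b α`
(`SetModel.exists_encodes_extending`). The result still extends all the earlier functions, because
those are decreasing with values at least `b β > b α`.

The whole chain has length `κ < 𝔱`, so it again has an upper bound `t`. The least `g` at which `t`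
stops being a decreasing function above the identity exists by foundation in `V`. It lies above
every `a α`, and below every `b β`, because otherwise `b γ < g` for some `γ`, whence
`b γ < t (b γ) ≤ t (a γ) = b γ`. So `g` fills the cut (`IsPreCut.exists_between_of_upperBound`).

The schemes of `ZFC⁻` are applied to definable classes; their definability is derived by instance
search through the class `SetModel.DefRel`.
-/

noncomputable section

/-! ### Definability with parameters -/

namespace SetModel

section Definability

variable {V : Type u} [setLanguage.Structure V] {α : Type}

/-- `P` is a relation on tuples of elements of `V` that is first-order definable with parameters.
It is a class so that instance search derives definability from the shape of `P`. -/
class DefRel (P : (α → V) → Prop) : Prop where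
  definable : (Set.univ : Set V).Definable setLanguage {v | P v}

/-- `f` is definable with parameters as a function of tuples of elements of `V`; the instances below
cover coordinates and constants. -/
class DefTerm (f : (α → V) → V) : Prop where
  definable : (Set.univ : Set V).DefinableFun setLanguage f

instance (i : α) : DefTerm (fun v : α → V => v i) := ⟨.proj _⟩

instance (c : V) : DefTerm (fun _ : α → V => c) :=
  ⟨Language.definableFun_const _ α (Set.mem_univ c)⟩

variable {P Q : (α → V) → Prop} {f g h : (α → V) → V}

instance [DefRel P] [DefRel Q] : DefRel (fun v => P v ∧ Q v) :=
  ⟨(DefRel.definable (P := P)).inter (DefRel.definable (P := Q))⟩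

instance [DefRel P] [DefRel Q] : DefRel (fun v => P v ∨ Q v) :=
  ⟨(DefRel.definable (P := P)).union (DefRel.definable (P := Q))⟩

instance [DefRel P] : DefRel (fun v => ¬ P v) :=
  ⟨(DefRel.definable (P := P)).compl⟩

instance [DefRel P] [DefRel Q] : DefRel (fun v => P v → Q v) :=
  ⟨by simpa only [imp_iff_not_or] using DefRel.definable (P := fun v => ¬ P v ∨ Q v)⟩

instance [DefRel P] [DefRel Q] : DefRel (fun v => P v ↔ Q v) :=
  ⟨by simpa only [iff_iff_implies_and_implies] using
    DefRel.definable (P := fun v => (P v → Q v) ∧ (Q v → P v))⟩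

instance {R : (α → V) → V → Prop}
    [H : DefRel (fun w : α ⊕ Unit → V => R (fun a => w (.inl a)) (w (.inr ())))] :
    DefRel (fun v => ∀ x, R v x) := by
  refine ⟨?_⟩
  convert H.definable.forall_of_finite using 1
  ext v
  exact ⟨fun hv u => hv (u ()), fun hv x => hv fun _ => x⟩

instance {R : (α → V) → V → Prop}
    [H : DefRel (fun w : α ⊕ Unit → V => R (fun a => w (.inl a)) (w (.inr ())))] :
    DefRel (fun v => ∃ x, R v x) := by
  refine ⟨?_⟩
  convert H.definable.exists_of_finite using 1
  ext v
  exact ⟨fun ⟨x, hx⟩ => ⟨fun _ => x, hx⟩, fun ⟨u, hu⟩ => ⟨u (), hu⟩⟩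

instance [DefTerm f] [DefTerm g] : DefRel (fun v => f v = g v) :=
  ⟨(DefTerm.definable (f := f)).ofPred_eq DefTerm.definable⟩

instance [DefTerm f] [DefTerm g] : DefRel (fun v => f v ∈ᵥ g v) := by
  have hrel (r : setLanguage.Relations 2) : (Set.univ : Set V).Definable setLanguage
      {w : Fin 2 → V | Language.Structure.RelMap r ![w 0, w 1]} := by
    refine (Set.empty_definable_iff.2 ⟨r.formula₂ (.var 0) (.var 1), ?_⟩).mono
      (Set.empty_subset _)
    ext w
    rw [Set.mem_ofPred_eq, Set.mem_ofPred_eq, Language.Formula.realize_rel₂]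
    rfl
  have hmem : (Set.univ : Set V).Definable setLanguage {w : Fin 2 → V | w 0 ∈ᵥ w 1} :=
    hrel SetLangRel.mem
  have hmap : (Set.univ : Set V).DefinableMap setLanguage (fun v => ![f v, g v]) := by
    intro i
    fin_cases i
    · exact DefTerm.definable (f := f)
    · exact DefTerm.definable (f := g)
  exact ⟨hmem.preimage_map hmap⟩

/-- Terms remain definable in a context with one more bound variable. -/
theorem DefTerm.weaken (f : (α → V) → V) [H : DefTerm f] :
    DefTerm (fun w : α ⊕ Unit → V => f fun a => w (.inl a)) := by
  refine ⟨?_⟩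
  exact H.definable.preimage_comp (fun o : Option α => (o.map Sum.inl : Option (α ⊕ Unit)))

instance [DefTerm f] [DefTerm g] [DefTerm h] :
    DefRel (fun v => IsUnorderedPair (f v) (g v) (h v)) := by
  have := DefTerm.weaken f
  have := DefTerm.weaken g
  have := DefTerm.weaken h
  unfold IsUnorderedPair; infer_instance

instance [DefTerm f] [DefTerm g] [DefTerm h] :
    DefRel (fun v => IsOrderedPair (f v) (g v) (h v)) := by
  have := DefTerm.weaken f
  have := DefTerm.weaken g
  have := DefTerm.weaken h
  unfold IsOrderedPair; infer_instance

instance [DefTerm f] [DefTerm g] [DefTerm h] :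
    DefRel (fun v => PairMem (f v) (g v) (h v)) := by
  have := DefTerm.weaken f
  have := DefTerm.weaken g
  have := DefTerm.weaken h
  unfold PairMem; infer_instance

variable [ModelsZFCMinus V]

/-- The separation scheme, with definability left to instance search. -/
theorem exists_separation (D : V → Prop) [H : DefRel fun v : Fin 1 → V => D (v 0)] (x : V) :
    ∃ y, ∀ z, z ∈ᵥ y ↔ z ∈ᵥ x ∧ D z :=
  ModelsZFCMinus.separation {z | D z} H.definable x

/-- The collection scheme, with definability left to instance search. -/
theorem exists_collection (R : V → V → Prop) [H : DefRel fun v : Fin 2 → V => R (v 0) (v 1)]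
    (x : V) (h : ∀ a, a ∈ᵥ x → ∃ b, R a b) : ∃ y, ∀ a, a ∈ᵥ x → ∃ b, b ∈ᵥ y ∧ R a b :=
  ModelsZFCMinus.collection {p | R p.1 p.2} H.definable x h

end Definability

/-! ### Pairs and natural numbers of a model -/

section Basic

variable {V : Type u} [setLanguage.Structure V]

theorem IsUnorderedPair.inj {w a b c d : V} (h : IsUnorderedPair w a b)
    (h' : IsUnorderedPair w c d) : (a = c ∧ b = d) ∨ (a = d ∧ b = c) := by
  have h1 := (h' a).1 ((h a).2 (.inl rfl))
  have h2 := (h' b).1 ((h b).2 (.inr rfl))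
  have h3 := (h c).1 ((h' c).2 (.inl rfl))
  have h4 := (h d).1 ((h' d).2 (.inr rfl))
  grind

variable [ModelsZFCMinus V]

theorem IsUnorderedPair.unique {w w' a b : V} (h : IsUnorderedPair w a b)
    (h' : IsUnorderedPair w' a b) : w = w' :=
  ModelsZFCMinus.extensionality _ _ fun z => (h z).trans (h' z).symm

theorem IsOrderedPair.unique {p q a b : V} (h : IsOrderedPair p a b) (h' : IsOrderedPair q a b) :
    p = q :=
  ModelsZFCMinus.extensionality _ _ fun z => (h z).trans (h' z).symm

theorem exists_isOrderedPair (a b : V) : ∃ p, IsOrderedPair p a b := by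
  obtain ⟨x, hx⟩ := ModelsZFCMinus.pairing a a
  obtain ⟨y, hy⟩ := ModelsZFCMinus.pairing a b
  obtain ⟨p, hp⟩ := ModelsZFCMinus.pairing x y
  refine ⟨p, fun w => (hp w).trans ⟨?_, ?_⟩⟩
  · rintro (rfl | rfl)
    exacts [.inl hx, .inr hy]
  · rintro (h | h)
    exacts [.inl (h.unique hx), .inr (h.unique hy)]

theorem IsOrderedPair.inj {p a b c d : V} (h : IsOrderedPair p a b) (h' : IsOrderedPair p c d) :
    a = c ∧ b = d := by
  obtain ⟨x, hx⟩ := ModelsZFCMinus.pairing a a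
  obtain ⟨y, hy⟩ := ModelsZFCMinus.pairing a b
  obtain ⟨z, hz⟩ := ModelsZFCMinus.pairing c d
  have h1 := (h' x).1 ((h x).2 (.inl hx))
  have h2 := (h' y).1 ((h y).2 (.inr hy))
  have h3 := (h z).1 ((h' z).2 (.inr hz))
  have ha : a = c := by
    rcases h1 with h1 | h1
    · have := hx.inj h1; grind
    · have := hx.inj h1; grind
  subst ha
  refine ⟨rfl, ?_⟩
  rcases h2 with h2 | h2
  · have e1 := hy.inj h2
    rcases h3 with h3 | h3
    · have := hz.inj h3; grind
    · have := hz.inj h3; grind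
  · have := hy.inj h2; grind

theorem exists_isSuccessor (x : V) : ∃ y, IsSuccessor y x := by
  obtain ⟨s, hs⟩ := ModelsZFCMinus.pairing x x
  obtain ⟨p, hp⟩ := ModelsZFCMinus.pairing x s
  obtain ⟨y, hy⟩ := ModelsZFCMinus.union p
  refine ⟨y, fun z => (hy z).trans ⟨?_, ?_⟩⟩
  · rintro ⟨w, hw, hz⟩
    rcases (hp w).1 hw with rfl | rfl
    · exact .inl hz
    · exact .inr (((hs z).1 hz).elim id id)
  · rintro (hz | rfl)
    · exact ⟨x, (hp x).2 (.inl rfl), hz⟩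
    · exact ⟨s, (hp s).2 (.inr rfl), (hs z).2 (.inl rfl)⟩

theorem IsSuccessor.unique {y y' x : V} (h : IsSuccessor y x) (h' : IsSuccessor y' x) : y = y' :=
  ModelsZFCMinus.extensionality _ _ fun z => (h z).trans (h' z).symm

/-- `n` is a natural number in the sense of `V`. -/
def IsNat (n : V) : Prop := ∀ x : V, IsInductive x → n ∈ᵥ x

/-- Induction in `V` for properties definable with parameters. -/
theorem IsNat.induction {D : V → Prop} [DefRel fun v : Fin 1 → V => D (v 0)]
    (zero : ∀ e, IsEmptySet e → D e) (succ : ∀ n n', IsSuccessor n' n → D n → D n') {n : V}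
    (hn : IsNat n) : D n := by
  obtain ⟨I, ⟨e, he, heI⟩, hI⟩ := ModelsZFCMinus.infinity (V := V)
  obtain ⟨y, hy⟩ := exists_separation D I
  refine ((hy n).1 (hn y ⟨⟨e, he, (hy e).2 ⟨heI, zero e he⟩⟩, fun m hm => ?_⟩)).2
  obtain ⟨m', hm', hm'I⟩ := hI m ((hy m).1 hm).1
  exact ⟨m', hm', (hy m').2 ⟨hm'I, succ m m' hm' ((hy m).1 hm).2⟩⟩

theorem not_mem_self (x : V) : ¬ x ∈ᵥ x := by
  intro h
  obtain ⟨w, hw⟩ := ModelsZFCMinus.pairing x x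
  obtain ⟨y, hy, hy'⟩ := ModelsZFCMinus.foundation w ⟨x, (hw x).2 (.inl rfl)⟩
  obtain rfl : y = x := ((hw y).1 hy).elim id id
  exact hy' y h hy

theorem IsNat.mem_trans {k m n : V} (hn : IsNat n) (hm : m ∈ᵥ n) (hk : k ∈ᵥ m) : k ∈ᵥ n := by
  refine IsNat.induction (D := fun n => ∀ m, m ∈ᵥ n → ∀ k, k ∈ᵥ m → k ∈ᵥ n) ?_ ?_ hn m hm k hk
  · exact fun e he m hm => (he m hm).elim
  · intro n n' hn' ih m hm k hk
    rcases (hn' m).1 hm with hm | rfl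
    · exact (hn' k).2 (.inl (ih m hm k hk))
    · exact (hn' k).2 (.inl hk)

theorem IsNat.of_mem {m n : V} (hn : IsNat n) (hm : m ∈ᵥ n) : IsNat m := by
  intro x hx
  refine (IsNat.induction (D := fun n => n ∈ᵥ x ∧ ∀ m, m ∈ᵥ n → m ∈ᵥ x) ?_ ?_ hn).2 m hm
  · intro e he
    obtain ⟨e', he', hx'⟩ := hx.1
    obtain rfl : e = e' := ModelsZFCMinus.extensionality _ _ fun z => iff_of_false (he z) (he' z)
    exact ⟨hx', fun m hm => (he m hm).elim⟩
  · intro n n' hn' ih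
    obtain ⟨s, hs, hsx⟩ := hx.2 n ih.1
    obtain rfl := hs.unique hn'
    refine ⟨hsx, fun m hm => ?_⟩
    rcases (hn' m).1 hm with hm | rfl
    exacts [ih.2 m hm, ih.1]

theorem IsNat.succ {n n' : V} (hn : IsNat n) (h : IsSuccessor n' n) : IsNat n' := by
  intro x hx
  obtain ⟨s, hs, hsx⟩ := hx.2 n (hn x hx)
  exact hs.unique h ▸ hsx

theorem IsNat.succ_mem_or_eq {m m' n : V} (hn : IsNat n) (hm : m ∈ᵥ n) (h : IsSuccessor m' m) :
    m' ∈ᵥ n ∨ m' = n := by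
  refine IsNat.induction (D := fun n => m ∈ᵥ n → m' ∈ᵥ n ∨ m' = n) ?_ ?_ hn hm
  · exact fun e he hm => (he m hm).elim
  · intro n n' hn' ih hm
    rcases (hn' m).1 hm with hm | rfl
    · exact .inl ((hn' m').2 (ih hm))
    · exact .inr (h.unique hn')

theorem IsNat.trichotomy {m n : V} (hm : IsNat m) (hn : IsNat n) : m ∈ᵥ n ∨ m = n ∨ n ∈ᵥ m := by
  refine IsNat.induction (D := fun m => m ∈ᵥ n ∨ m = n ∨ n ∈ᵥ m) ?_ ?_ hm
  · intro e he
    have : e ∈ᵥ n ∨ e = n := by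
      refine IsNat.induction (D := fun n => e ∈ᵥ n ∨ e = n) ?_ ?_ hn
      · exact fun e' he' =>
          .inr (ModelsZFCMinus.extensionality _ _ fun z => iff_of_false (he z) (he' z))
      · exact fun n n' hn' ih => .inl ((hn' e).2 ih)
    exact this.imp_right .inl
  · intro m m' hm' ih
    rcases ih with h | rfl | h
    · exact (hn.succ_mem_or_eq h hm').imp_right .inl
    · exact .inr (.inr ((hm' m).2 (.inr rfl)))
    · exact .inr (.inr ((hm' n).2 (.inl h)))

theorem IsNat.asymm {m n : V} (hn : IsNat n) (h : m ∈ᵥ n) : ¬ n ∈ᵥ m :=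
  fun h' => not_mem_self n (hn.mem_trans h h')

/-- A nonempty definable class of natural numbers of `V` has a least element. -/
theorem IsNat.exists_least (D : V → Prop) [DefRel fun v : Fin 1 → V => D (v 0)] {n : V}
    (hn : IsNat n) (h : D n) : ∃ m, IsNat m ∧ D m ∧ ∀ k, k ∈ᵥ m → ¬ D k := by
  obtain ⟨n', hn'⟩ := exists_isSuccessor n
  obtain ⟨y, hy⟩ := exists_separation D n'
  obtain ⟨m, hm, hmin⟩ := ModelsZFCMinus.foundation y ⟨n, (hy n).2 ⟨(hn' n).2 (.inr rfl), h⟩⟩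
  have hmn := ((hy m).1 hm).1
  exact ⟨m, (hn.succ hn').of_mem hmn, ((hy m).1 hm).2, fun k hk hDk =>
    hmin k hk ((hy k).2 ⟨(hn.succ hn').mem_trans hmn hk, hDk⟩)⟩

end Basic

end SetModel

/-! ### Chains in partial orders -/

/-- Transfinite recursion along a well-order: if every partial chain of the required kind can be
continued, there is a full chain. -/
theorem exists_monotone_of_forall_extends {ι T : Type*} [LinearOrder ι] [WellFoundedLT ι]
    [Preorder T] [Nonempty T] (G : ι → T → Prop)
    (h : ∀ i (f : Set.Iio i → T), Monotone f → (∀ j, G j.1 (f j)) → ∃ t, G i t ∧ ∀ j, f j ≤ t) :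
    ∃ F : ι → T, Monotone F ∧ ∀ i, G i (F i) := by
  let F : ι → T := WellFoundedLT.fix (motive := fun _ => T) fun i f =>
    Classical.epsilon fun t => G i t ∧ ∀ j (hj : j < i), f j hj ≤ t
  have hF (i : ι) : F i = Classical.epsilon fun t => G i t ∧ ∀ j, j < i → F j ≤ t :=
    WellFoundedLT.fix_eq _ _
  have key (i : ι) : G i (F i) ∧ ∀ j, j < i → F j ≤ F i := by
    induction i using WellFoundedLT.induction with
    | ind i ih =>
      have hex : ∃ t, G i t ∧ ∀ j, j < i → F j ≤ t := by
        have hmono : Monotone fun j : Set.Iio i => F j := fun j k hjk => by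
          rcases hjk.eq_or_lt with rfl | hlt
          exacts [le_rfl, (ih k k.2).2 j hlt]
        obtain ⟨t, ht, hle⟩ := h i _ hmono fun j => (ih j j.2).1
        exact ⟨t, ht, fun j hj => hle ⟨j, hj⟩⟩
      rw [hF i]
      exact Classical.epsilon_spec hex
  refine ⟨F, fun j i hji => ?_, fun i => (key i).1⟩
  rcases hji.eq_or_lt with rfl | hlt
  exacts [le_rfl, (key i).2 j hlt]

/-- A chain indexed by an arbitrary ordinal has an upper bound as soon as all chains indexed by
cardinals up to the cardinality of that ordinal have one: pass to a fundamental sequence. -/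
theorem exists_upperBound_of_strictMono {T : Type u} [Preorder T] {o : Ordinal.{u}}
    (hT : ∀ μ : Cardinal.{u}, μ ≤ o.card → ¬ HasUnboundedChain T μ) {f : Set.Iio o → T}
    (hf : StrictMono f) : ∃ t, ∀ i, f i ≤ t := by
  obtain ⟨g, hg⟩ := Ordinal.exists_isFundamentalSeq (o := o) rfl
  by_contra hno
  refine hT o.cof o.cof_le_card ⟨f ∘ g, hf.comp hg.strictMono, fun ⟨t, ht⟩ => hno ⟨t, fun i => ?_⟩⟩
  obtain ⟨_, ⟨k, rfl⟩, hk⟩ := hg.isCofinal_range i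
  exact (hf.monotone hk).trans (ht k)

namespace SetModel

/-! ### Functions of a model encoding a pair of natural numbers -/

section Encoding

variable {V : Type u} [setLanguage.Structure V]

/-- In `V`: `s` is a weakly decreasing function with domain `{0, …, a}` and last value `b`. As an
element of a tree of finite sequences it stands for the pair `(a, b)`. -/
structure Encodes (s a b : V) : Prop where
  dom : ∀ i, (∃ v, PairMem s i v) ↔ i ∈ᵥ a ∨ i = a
  anti : ∀ i j v w, PairMem s i v → PairMem s j w → i ∈ᵥ j → w ∈ᵥ v ∨ w = v
  last : PairMem s a b

/-- In `V`: `v` is the value of `t` at `j`, and `t` takes no smaller value before `j`. -/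
def IsRunningMin (t j v : V) : Prop :=
  PairMem t j v ∧ ∀ i w, i ∈ᵥ j → PairMem t i w → v ∈ᵥ w ∨ v = w

instance {α : Type} {f g h : (α → V) → V} [DefTerm f] [DefTerm g] [DefTerm h] :
    DefRel (fun v => IsRunningMin (f v) (g v) (h v)) := by
  have := DefTerm.weaken f
  have := DefTerm.weaken g
  have := DefTerm.weaken h
  have := DefTerm.weaken fun w : α ⊕ Unit → V => f fun a => w (.inl a)
  have := DefTerm.weaken fun w : α ⊕ Unit → V => g fun a => w (.inl a)
  have := DefTerm.weaken fun w : α ⊕ Unit → V => h fun a => w (.inl a)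
  unfold IsRunningMin; infer_instance

theorem PairMem.mono {s t i v : V} (h : PairMem s i v) (hst : ∀ z, z ∈ᵥ s → z ∈ᵥ t) :
    PairMem t i v :=
  let ⟨p, hp, hps⟩ := h; ⟨p, hp, hst p hps⟩

variable [ModelsZFCMinus V]

theorem PairMem.mem_of_isFunctionFromTo {s m n i v : V} (h : PairMem s i v)
    (hs : IsFunctionFromTo s m n) : i ∈ᵥ m ∧ v ∈ᵥ n := by
  obtain ⟨p, hp, hps⟩ := h
  obtain ⟨j, w, hj, hw, hp'⟩ := hs.1 p hps
  obtain ⟨rfl, rfl⟩ := hp.inj hp'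
  exact ⟨hj, hw⟩

theorem PairMem.unique_of_isFunctionFromTo {s m n i v w : V} (h : PairMem s i v)
    (h' : PairMem s i w) (hs : IsFunctionFromTo s m n) : v = w :=
  (hs.2 i (h.mem_of_isFunctionFromTo hs).1).unique h h'

/-- Replacement: a definable functional relation on a set is a function in `V`. -/
theorem exists_isFunctionFromTo (R : V → V → Prop)
    [∀ (α : Type) (i j : α), DefRel fun v : α → V => R (v i) (v j)] {m n : V}
    (hR : ∀ i, i ∈ᵥ m → ∃! v, R i v) (hn : ∀ i v, i ∈ᵥ m → R i v → v ∈ᵥ n) :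
    ∃ s, IsFunctionFromTo s m n ∧ ∀ i v, PairMem s i v ↔ i ∈ᵥ m ∧ R i v := by
  obtain ⟨y, hy⟩ := exists_collection (fun i p => ∃ v, IsOrderedPair p i v ∧ R i v) m
    fun i hi => by
      obtain ⟨v, hv, -⟩ := hR i hi
      obtain ⟨p, hp⟩ := exists_isOrderedPair i v
      exact ⟨p, v, hp, hv⟩
  obtain ⟨s, hs⟩ := exists_separation
    (fun p => ∃ i, i ∈ᵥ m ∧ ∃ v, IsOrderedPair p i v ∧ R i v) y
  have hpair (i v : V) : PairMem s i v ↔ i ∈ᵥ m ∧ R i v := by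
    constructor
    · rintro ⟨p, hp, hps⟩
      obtain ⟨-, j, hj, w, hp', hw⟩ := (hs p).1 hps
      obtain ⟨rfl, rfl⟩ := hp.inj hp'
      exact ⟨hj, hw⟩
    · rintro ⟨hi, hv⟩
      obtain ⟨p, hpy, w, hp, hw⟩ := hy i hi
      obtain rfl := (hR i hi).unique hv hw
      exact ⟨p, hp, (hs p).2 ⟨hpy, i, hi, v, hp, hv⟩⟩
  refine ⟨s, ⟨fun p hp => ?_, fun i hi => ?_⟩, hpair⟩
  · obtain ⟨-, i, hi, v, hp', hv⟩ := (hs p).1 hp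
    exact ⟨i, v, hi, hn i v hi hv, hp'⟩
  · obtain ⟨v, hv, huniq⟩ := hR i hi
    exact ⟨v, (hpair i v).2 ⟨hi, hv⟩, fun w hw => huniq w ((hpair i w).1 hw).2⟩

theorem Encodes.exists_isRunningMin {s t m n a b : V} (hs : Encodes s a b)
    (ht : IsFunctionFromTo t m n) (hst : ∀ z, z ∈ᵥ s → z ∈ᵥ t) (ha : IsNat a) {j : V}
    (hj : j ∈ᵥ a ∨ j = a) : ∃ v, IsRunningMin t j v ∧ (b ∈ᵥ v ∨ b = v) := by
  obtain ⟨v, hv⟩ := (hs.dom j).2 hj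
  refine ⟨v, ⟨hv.mono hst, fun i w hi hw => ?_⟩, ?_⟩
  · have hia : i ∈ᵥ a := by
      rcases hj with hj | rfl
      exacts [ha.mem_trans hj hi, hi]
    obtain ⟨w', hw'⟩ := (hs.dom i).2 (.inl hia)
    obtain rfl := (hw'.mono hst).unique_of_isFunctionFromTo hw ht
    exact hs.anti i j w' v hw' hv hi
  · rcases hj with hj | rfl
    · exact hs.anti j a v b hv hs.last hj
    · exact .inr ((hs.last.mono hst).unique_of_isFunctionFromTo (hv.mono hst) ht)

/-- Any function `t` of `V` can be modified to a function encoding `(a, b)` which still extends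
every function below `t` that encodes a pair `(c, d)` with `c < a` and `b < d`: keep `t` as long as it is
decreasing with values above `b`, and continue with the constant value `b`. -/
theorem exists_encodes_extending {t m n a a' b : V} (ht : IsFunctionFromTo t m n)
    (hn : IsNat n) (ha : IsNat a) (ha' : IsSuccessor a' a) (hb : b ∈ᵥ n) :
    ∃ s, IsFunctionFromTo s a' n ∧ Encodes s a b ∧
      ∀ s' c c' d, IsFunctionFromTo s' c' n → Encodes s' c d → c ∈ᵥ a → b ∈ᵥ d →
        (∀ z, z ∈ᵥ s' → z ∈ᵥ t) → ∀ z, z ∈ᵥ s' → z ∈ᵥ s := by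
  let safe (i : V) : Prop :=
    i ∈ᵥ a ∧ ∀ j, j ∈ᵥ i ∨ j = i → ∃ v, IsRunningMin t j v ∧ b ∈ᵥ v
  have hsafe (α : Type) (i : α) : DefRel fun v : α → V => safe (v i) := by
    dsimp only [safe]; infer_instance
  obtain ⟨s, hs, hpair⟩ := exists_isFunctionFromTo
    (fun i v => (safe i ∧ PairMem t i v) ∨ (¬ safe i ∧ v = b)) (m := a') (n := n)
    (fun i _ => by
      by_cases hi : safe i
      · obtain ⟨v, hv, -⟩ := hi.2 i (.inr rfl)
        refine ⟨v, .inl ⟨hi, hv.1⟩, ?_⟩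
        rintro w (⟨-, hw⟩ | ⟨hi', -⟩)
        exacts [hw.unique_of_isFunctionFromTo hv.1 ht, (hi' hi).elim]
      · exact ⟨b, .inr ⟨hi, rfl⟩, fun w hw => hw.elim (fun h => (hi h.1).elim) And.right⟩)
    (by
      rintro i v - (⟨-, hv⟩ | ⟨-, rfl⟩)
      exacts [(hv.mem_of_isFunctionFromTo ht).2, hb])
  have hlast : PairMem s a b :=
    (hpair a b).2 ⟨(ha' a).2 (.inr rfl), .inr ⟨fun h => not_mem_self a h.1, rfl⟩⟩
  refine ⟨s, hs, ⟨fun i => ?_, fun i j v w hv hw hij => ?_, hlast⟩, ?_⟩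
  · rw [← ha' i]
    exact ⟨fun ⟨v, hv⟩ => ((hpair i v).1 hv).1, fun hi => (hs.2 i hi).exists⟩
  · obtain ⟨hi, hv⟩ := (hpair i v).1 hv
    obtain ⟨hj, hw⟩ := (hpair j w).1 hw
    rcases hw with ⟨hjs, hw⟩ | ⟨-, rfl⟩
    · have his : safe i := ⟨ha.mem_trans hjs.1 hij, fun k hk => hjs.2 k <| .inl <| by
        rcases hk with hk | rfl
        exacts [(ha.of_mem hjs.1).mem_trans hij hk, hij]⟩
      obtain ⟨w', hw', -⟩ := hjs.2 j (.inr rfl)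
      obtain rfl := hw'.1.unique_of_isFunctionFromTo hw ht
      rcases hv with ⟨-, hv⟩ | ⟨hi', -⟩
      exacts [hw'.2 i v hij hv, (hi' his).elim]
    · rcases hv with ⟨his, hv⟩ | ⟨-, rfl⟩
      · obtain ⟨v', hv', hbv⟩ := his.2 i (.inr rfl)
        obtain rfl := hv'.1.unique_of_isFunctionFromTo hv ht
        exact .inl hbv
      · exact .inr rfl
  · intro s' c c' d hs' henc hca hbd hst z hz
    obtain ⟨i, v, -, -, hp⟩ := hs'.1 z hz
    have hic : i ∈ᵥ c ∨ i = c := (henc.dom i).1 ⟨v, z, hp, hz⟩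
    have hia : i ∈ᵥ a := by
      rcases hic with hic | rfl
      exacts [ha.mem_trans hca hic, hca]
    have his : safe i := by
      refine ⟨hia, fun j hj => ?_⟩
      have hjc : j ∈ᵥ c ∨ j = c := by
        rcases hj with hj | rfl
        · rcases hic with hic | rfl
          exacts [.inl ((ha.of_mem hca).mem_trans hic hj), .inl hj]
        · exact hic
      obtain ⟨w, hw, hdw⟩ := henc.exists_isRunningMin ht hst (ha.of_mem hca) hjc
      refine ⟨w, hw, ?_⟩
      rcases hdw with hdw | rfl
      · exact (hn.of_mem (hw.1.mem_of_isFunctionFromTo ht).2).mem_trans hdw hbd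
      · exact hbd
    obtain ⟨q, hq, hqs⟩ := (hpair i v).2
      ⟨(ha' i).2 (.inl hia), .inl ⟨his, z, hp, hst z hz⟩⟩
    rwa [hp.unique hq]

end Encoding

end SetModel

/-! ### Symmetric cuts -/

section SymmetricCuts

open SetModel

variable {V : Type u} [setLanguage.Structure V] [ModelsZFCMinus V]

/-- If every chain of length at most `κ` in each tree `n^{<n}` is bounded, a symmetric pre-cut of
length `κ` can be followed by a chain of functions encoding its pairs of terms. -/
theorem IsPreCut.exists_chain_encodes {κ : Cardinal.{u}} {a b : Set.Iio κ.ord → OmegaHat V}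
    (hab : IsPreCut κ κ a b) {n : OmegaHat V} (hn : ∀ β, b β < n)
    (hT : ∀ μ ≤ κ, ¬ HasUnboundedChain (SeqTree n) μ) :
    ∃ F : Set.Iio κ.ord → SeqTree n, StrictMono F ∧
      ∀ α, Encodes (F α).1 (a α).1 (b α).1 := by
  have hstrict {α β : Set.Iio κ.ord} {s t : SeqTree n} (hs : Encodes s.1 (a α).1 (b α).1)
      (ht : Encodes t.1 (a β).1 (b β).1) (hαβ : α < β) (hst : s ≤ t) : s < t := by
    refine lt_of_le_of_ne hst fun he => ?_
    have h1 : (a α).1 ∈ᵥ (a β).1 := hab.left_increasing α β hαβ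
    rw [← he] at ht
    rcases (hs.dom _).1 ⟨_, ht.last⟩ with h | h
    · exact IsNat.asymm (a β).2 h1 h
    · exact not_mem_self _ (h ▸ h1)
  have : Nonempty (SeqTree n) := by
    by_contra hne
    have : IsEmpty (Set.Iio (0 : Cardinal.{u}).ord) := ⟨fun i => by simpa using i.2⟩
    exact hT 0 zero_le ⟨isEmptyElim, isEmptyElim, fun ⟨t, _⟩ => hne ⟨t⟩⟩
  obtain ⟨F, hF, henc⟩ := exists_monotone_of_forall_extends
    (fun α (s : SeqTree n) => Encodes s.1 (a α).1 (b α).1) fun α f hf henc => by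
      -- The indices below `α` form an initial segment of the ordinals.
      let e : Set.Iio (α : Ordinal) → Set.Iio α := fun i =>
        ⟨⟨i, Set.mem_Iio.2 (lt_trans i.2 α.2)⟩, i.2⟩
      obtain ⟨t, ht⟩ := exists_upperBound_of_strictMono (f := f ∘ e)
        (fun μ hμ => hT μ (hμ.trans (Cardinal.lt_ord.1 α.2).le))
        (fun i j hij => hstrict (henc (e i)) (henc (e j)) hij (hf hij.le))
      obtain ⟨m, -, htm⟩ := t.2
      obtain ⟨a', ha'⟩ := exists_isSuccessor (a α).1
      have hbn : (b α).1 ∈ᵥ n.1 := hn α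
      have hab' : (a α).1 ∈ᵥ (b α).1 := hab.left_lt_right α α
      have ha'n : a' ∈ᵥ n.1 := by
        rcases IsNat.succ_mem_or_eq (b α).2 hab' ha' with h | rfl
        exacts [IsNat.mem_trans n.2 hbn h, hbn]
      obtain ⟨s, hs, hsenc, hext⟩ := exists_encodes_extending htm n.2 (a α).2 ha' hbn
      refine ⟨⟨s, ⟨a', IsNat.succ (a α).2 ha'⟩, ha'n, hs⟩, hsenc, fun j => ?_⟩
      obtain ⟨k, -, hk⟩ := (f j).2
      exact hext _ _ _ _ hk (henc j) (hab.left_increasing _ _ j.2)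
        (hab.right_decreasing _ _ j.2) (ht ⟨j, j.2⟩)
  exact ⟨F, fun α β hαβ => hstrict (henc α) (henc β) hαβ (hF hαβ.le), henc⟩

/-- An upper bound of the chain of encoding functions yields a number filling the pre-cut, namely the
first place `g` at which the bound `t` stops being a decreasing function lying above the identity.
It cannot lie above some `b β`, as `t (b β) ≤ t (a β) = b β`. -/
theorem IsPreCut.exists_between_of_upperBound {κ : Cardinal.{u}}
    {a b : Set.Iio κ.ord → OmegaHat V} (hab : IsPreCut κ κ a b) {n : OmegaHat V}
    {F : Set.Iio κ.ord → SeqTree n} (henc : ∀ α, Encodes (F α).1 (a α).1 (b α).1)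
    {t : SeqTree n} (ht : ∀ α, F α ≤ t) : ∃ c, (∀ α, a α < c) ∧ ∀ β, c < b β := by
  obtain ⟨m, -, htm⟩ := t.2
  obtain ⟨g, hg, hgt, hmin⟩ := IsNat.exists_least
    (fun j => ¬ ∃ v, IsRunningMin t.1 j v ∧ j ∈ᵥ v) m.2
    (fun ⟨v, hv, _⟩ => not_mem_self _ (hv.1.mem_of_isFunctionFromTo htm).1)
  have hag (α) : (a α).1 ∈ᵥ g := by
    by_contra hnot
    have hga : g ∈ᵥ (a α).1 ∨ g = (a α).1 := by
      rcases IsNat.trichotomy (a α).2 hg with h | h | h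
      exacts [(hnot h).elim, .inr h.symm, .inl h]
    obtain ⟨v, hv, hbv⟩ := (henc α).exists_isRunningMin htm (ht α) (a α).2 hga
    have hab' : (a α).1 ∈ᵥ (b α).1 := hab.left_lt_right α α
    have hgb : g ∈ᵥ (b α).1 := by
      rcases hga with h | rfl
      exacts [IsNat.mem_trans (b α).2 hab' h, hab']
    refine hgt ⟨v, hv, ?_⟩
    rcases hbv with h | rfl
    exacts [(IsNat.of_mem n.2 (hv.1.mem_of_isFunctionFromTo htm).2).mem_trans h hgb, hgb]
  have hbg (β) : ¬ (b β).1 ∈ᵥ g := by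
    intro h
    obtain ⟨v, hv, hbv⟩ := not_not.1 (hmin _ h)
    rcases hv.2 _ _ (hab.left_lt_right β β) ((henc β).last.mono (ht β)) with h' | rfl
    exacts [IsNat.asymm (b β).2 h' hbv, not_mem_self _ hbv]
  refine ⟨⟨g, hg⟩, hag, fun β => ?_⟩
  have hlim := Cardinal.isSuccLimit_ord hab.regular_left.aleph0_le
  have hβ : (b ⟨_, hlim.succ_lt β.2⟩).1 ∈ᵥ (b β).1 :=
    hab.right_decreasing β _ (Order.lt_succ (β : Ordinal))
  rcases IsNat.trichotomy hg (b β).2 with h | rfl | h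
  exacts [h, (hbg _ hβ).elim, (hbg _ h).elim]

end SymmetricCuts

end

theorem mainTheorem7 (V : Type u) [setLanguage.Structure V] [ModelsZFCMinus V]
    (hV : OmegaNonstandard V) (hpt : pCard V < tCard V)
    (κ : Cardinal.{u}) (hκ : (κ : WithTop Cardinal.{u}) = pCard V) :
    (κ, κ) ∉ cutSpectrum (OmegaHat V) := by
  rintro ⟨a, b, hab, hcut⟩
  have hpos : 0 < κ.ord :=
    Cardinal.ord_pos.2 (Cardinal.aleph0_pos.trans_le hab.regular_left.aleph0_le)
  obtain ⟨n, hn⟩ := SetModel.exists_isSuccessor (b ⟨0, hpos⟩).1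
  let N : OmegaHat V := ⟨n, SetModel.IsNat.succ (b ⟨0, hpos⟩).2 hn⟩
  have hbN (β) : b β < N := by
    refine (hn _).2 ?_
    rcases (zero_le : (0 : Ordinal) ≤ β).eq_or_lt with h | h
    · exact .inr (congrArg (fun γ => (b γ).1) (Subtype.ext h.symm))
    · exact .inl (hab.right_decreasing ⟨0, hpos⟩ β h)
  -- `N` is nonzero, so the minima defining `𝔱` range over its tree.
  have hT (μ) (hμ : μ ≤ κ) : ¬ HasUnboundedChain (SeqTree N) μ := by
    intro h
    refine hpt.not_ge ?_
    rw [← hκ]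
    exact ((iInf₂_le N ⟨_, hbN ⟨0, hpos⟩⟩).trans (iInf₂_le μ h)).trans (WithTop.coe_le_coe.2 hμ)
  obtain ⟨F, hF, henc⟩ := hab.exists_chain_encodes hbN hT
  obtain ⟨t, ht⟩ := not_not.1 fun hno => hT κ le_rfl ⟨F, hF, hno⟩
  exact hcut (hab.exists_between_of_upperBound henc ht)
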